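/- Let $n\ge 0$ and let $\mathcal P=\mathbb Q[x,x_1,\dots,x_n]$. Fix polynomials $p_1,\dots,p_n\in\mathcal P$ and values $r_1,\dots,r_n\in\mathbb Q$, regarded as the initial value problem $\dot x_i=p_i$, $x_i(0)=r_i$ $(1\le i\le n)$. Put $x_0=x$, $\mathcal D(x_0)=1$, $\mathcal D(x_i)=p_i$ for $1\le i\le n$, and let $o(p)\in\mathbb Q$ be the value of $p\in\mathcal P$ at $(x,x_1,\dots,x_n)=(0,r_1,\dots,r_n)$. Let $\delta_\times:\mathcal P\to\mathcal P$ be the $\mathbb Q$-linear map defined recursively on monomials by $$\delta_\times(1)=0,\qquad \delta_\times(x_i)=\mathcal D(x_i),\qquad \delta_\times(x_i m)=\mathcal D(x_i)\,m+x_i\,\delta_\times(m)-x\,\mathcal D(x_i)\,\delta_\times(m),$$ the last equation for every monomial $m\ne 1$ and every $0\le i\le n$ such that $x_i$ is the variable of smallest index occurring in $x_i m$. (This is the transition function associated with the convolution product of streams $(\sigma\times\tau)(k)=\sum_{j=0}^{k}\sigma(j)\tau(k-j)$, whose derivative satisfies $(\sigma\times\tau)'=\sigma'\times\tau+\sigma\times\tau'-x\times\sigma'\times\tau'$,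 where $\sigma'$ is $\sigma$ without its first element and $x=(0,1,0,0,\dots)$.) Let $\mu_\times:\mathcal P\to\mathbb Q^{\mathbb N}$ be the unique coalgebra morphism, i.e. the unique map with $\mu_\times(p)(0)=o(p)$ and $\mu_\times(p)'=\mu_\times(\delta_\times(p))$ for all $p\in\mathcal P$; explicitly, $\mu_\times(p)=(o(p),o(\delta_\times(p)),o(\delta_\times(\delta_\times(p))),\dots)$. Then for every $p\in\mathcal P$ the stream $\mu_\times(p)$ is algebraic: there is a nonzero polynomial $q(x,y)\in\mathbb Q[x,y]$ such that the ordinary generating function $g(z)=\sum_{j\ge 0}\mu_\times(p)(j)\,z^j\in\mathbb Q[[z]]$ satisfies $q(z,g(z))=0$. -/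

import Mathlib

/-! Streams over a field, the coalgebra structure on polynomials induced by a polynomial initial
value problem and a stream product of `(F, G)`-format, and the induced coalgebra morphism. -/

namespace PolyStream

/-- The polynomials `K[x, x₁, …, xₙ]`. The independent variable `x` is the variable of index `0`,
the dependent variable `xᵢ` (for `1 ≤ i ≤ n`) is the variable of index `i`. -/
abbrev Poly (K : Type*) [Field K] (n : ℕ) : Type _ := MvPolynomial (Fin (n + 1)) K

/-- An initial value problem `ẋ₁ = p₁, …, ẋₙ = pₙ`, `xᵢ(0) = rᵢ`, with `pᵢ ∈ K[x, x₁, …, xₙ]` and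
`rᵢ ∈ K`. -/
structure IVP (K : Type*) [Field K] (n : ℕ) where
  /-- the drifts `p₁, …, pₙ` -/
  drift : Fin n → Poly K n
  /-- the initial values `r₁, …, rₙ` -/
  init : Fin n → K

section

variable {K : Type*} [Field K] {n : ℕ}

/-- The drifts as a function on `{x, x₁, …, xₙ}`, extended by `ẋ = 1`. -/
noncomputable def IVP.driftExt (E : IVP K n) : Fin (n + 1) → Poly K n :=
  Fin.cons 1 E.drift

/-- The initial condition as a function on `{x, x₁, …, xₙ}`, extended by `x(0) = 0`. -/
def IVP.initExt (E : IVP K n) : Fin (n + 1) → K :=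
  Fin.cons 0 E.init

/-- The output `o(p)`: the value of `p` at the initial condition. -/
noncomputable def IVP.output (E : IVP K n) (p : Poly K n) : K :=
  MvPolynomial.eval E.initExt p

/-- The smallest variable that occurs in a monomial `m ≠ 1`; monomials are written as exponent
vectors. -/
def minVar (m : Fin (n + 1) →₀ ℕ) (hm : m ≠ 0) : Fin (n + 1) :=
  m.support.min' (Finsupp.support_nonempty_iff.mpr hm)

theorem degree_sub_minVar_lt (m : Fin (n + 1) →₀ ℕ) (hm : m ≠ 0) :
    (m - Finsupp.single (minVar m hm) 1).degree < m.degree := by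
  have h1 : Finsupp.single (minVar m hm) 1 ≤ m := by
    rw [Finsupp.single_le_iff]
    have h2 : minVar m hm ∈ m.support := Finset.min'_mem _ _
    exact Nat.one_le_iff_ne_zero.mpr (Finsupp.mem_support_iff.mp h2)
  have h3 : (m - Finsupp.single (minVar m hm) 1).degree
      + (Finsupp.single (minVar m hm) 1).degree = m.degree := by
    rw [← map_add, tsub_add_cancel_of_le h1]
  rw [Finsupp.degree_single] at h3
  omega

open Classical in
/-- The transition function on monomials for a product given by
`F ∈ K[x, y₁, y₂, y₃, y₄]` and `G ∈ K[y₁]`: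
`δ(1) = G(1)`, `δ(xᵢ) = D(xᵢ)`, and `δ(xᵢ m) = F(x, xᵢ, δ(xᵢ), m, δ(m))` if `m ≠ 1` and `xᵢ` is the
smallest variable occurring in `xᵢ m`. -/
noncomputable def IVP.transMonomial (E : IVP K n) (F : MvPolynomial (Fin 5) K) (G : Polynomial K)
    (m : Fin (n + 1) →₀ ℕ) : Poly K n :=
  if hm : m = 0 then
    Polynomial.aeval (1 : Poly K n) G
  else if m - Finsupp.single (minVar m hm) 1 = 0 then
    E.driftExt (minVar m hm)
  else
    MvPolynomial.aeval
      ![MvPolynomial.X 0,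
        MvPolynomial.X (minVar m hm),
        E.driftExt (minVar m hm),
        MvPolynomial.monomial (m - Finsupp.single (minVar m hm) 1) 1,
        E.transMonomial F G (m - Finsupp.single (minVar m hm) 1)] F
termination_by m.degree
decreasing_by exact degree_sub_minVar_lt m hm

/-- The transition function `δ` on polynomials: the linear extension of `transMonomial`. -/
noncomputable def IVP.trans (E : IVP K n) (F : MvPolynomial (Fin 5) K) (G : Polynomial K) :
    Poly K n →ₗ[K] Poly K n :=
  (MvPolynomial.basisMonomials (Fin (n + 1)) K).constr K (E.transMonomial F G)

/-- A coalgebra morphism from the polynomials, with output `o` and transition `δ`, to the streams,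
with output `σ ↦ σ(0)` and transition `σ ↦ σ'` (removal of the first element). -/
def IVP.IsCoalgebraMorphism (E : IVP K n) (F : MvPolynomial (Fin 5) K) (G : Polynomial K)
    (μ : Poly K n → Stream' K) : Prop :=
  ∀ p, (μ p).head = E.output p ∧ (μ p).tail = μ (E.trans F G p)

/-- The coalgebra morphism from polynomials to streams: `μ(p) = (o(p), o(δ(p)), o(δ(δ(p))), …)`. -/
noncomputable def IVP.mu (E : IVP K n) (F : MvPolynomial (Fin 5) K) (G : Polynomial K) :
    Poly K n → Stream' K :=
  Stream'.corec E.output (E.trans F G)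

/-- `mu` is the unique coalgebra morphism from polynomials to streams. -/
theorem IVP.isCoalgebraMorphism_iff (E : IVP K n) (F : MvPolynomial (Fin 5) K)
    (G : Polynomial K) (μ : Poly K n → Stream' K) :
    E.IsCoalgebraMorphism F G μ ↔ μ = E.mu F G := by
  constructor
  · intro h
    have key : ∀ k p, (μ p).get k = (E.mu F G p).get k := by
      intro k
      induction k with
      | zero =>
        intro p
        exact (h p).1
      | succ k ih =>
        intro p
        have h1 : (μ p).get (k + 1) = (μ p).tail.get k := rfl
        have h2 : (E.mu F G p).get (k + 1) = (E.mu F G (E.trans F G p)).get k := by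
          rw [IVP.mu, Stream'.corec_eq, Stream'.get_succ, Stream'.tail_cons]
        rw [h1, (h p).2, h2, ih]
    funext p
    exact Stream'.ext fun k => key k p
  · rintro rfl p
    rw [IVP.mu, Stream'.corec_eq]
    exact ⟨rfl, rfl⟩

variable (K) in
/-- The polynomial `F_× = y₂ y₃ + y₁ y₄ - x y₂ y₄` of the convolution product, read off from
`(σ × τ)' = σ' × τ + σ × τ' - x × σ' × τ'`; the variables `x, y₁, …, y₄` have the indices
`0, 1, …, 4`, and stand for `x, σ, σ', τ, τ'`. -/
noncomputable def convF : MvPolynomial (Fin 5) K :=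
  MvPolynomial.X 2 * MvPolynomial.X 3 + MvPolynomial.X 1 * MvPolynomial.X 4
    - MvPolynomial.X 0 * MvPolynomial.X 2 * MvPolynomial.X 4

/-- The coalgebra morphism `μ_×` of the convolution product, for which `F = F_×` and `G = 0`. -/
noncomputable def IVP.muConv (E : IVP K n) : Poly K n → Stream' K :=
  E.mu (convF K) 0

/-- The ordinary generating function `∑ σ(j) z ^ j` of a stream, as a formal power series. -/
noncomputable def ogf (σ : Stream' K) : PowerSeries K :=
  PowerSeries.mk σ.get

/-- A power series `g` is algebraic if `q(z, g(z)) = 0` for a nonzero polynomial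
`q(x, y) ∈ K[x, y]`. -/
def IsAlgebraicSeries (g : PowerSeries K) : Prop :=
  ∃ q : MvPolynomial (Fin 2) K, q ≠ 0 ∧
    MvPolynomial.aeval ![(PowerSeries.X : PowerSeries K), g] q = 0

/-- A stream is algebraic if its ordinary generating function is. -/
def IsAlgebraicStream (σ : Stream' K) : Prop :=
  IsAlgebraicSeries (ogf σ)

end

end PolyStream

/-!
The recursion for `δ` on monomials says that `x δ(p) = p - θ(p)`, where `θ` is the algebra
endomorphism with `θ(xᵢ) = xᵢ - x D(xᵢ)` (`IVP.X_mul_trans`). As `x` is not a zero divisor, this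
yields `δ(p q) = δ(p) q + p δ(q) - x δ(p) δ(q)` for all `p` and `q` (`IVP.trans_mul`), and by
coinduction the map from `p` to the generating function of `μ(p)` is an algebra homomorphism to the
power series (`IVP.genHom`), which maps `x` to the power series variable.

Therefore the generating functions `yᵢ` of `μ(xᵢ)` solve the polynomial system
`yᵢ = xᵢ(0) + x D(xᵢ)(y)`, and the generating function of `μ(p)` is `p(y)`. The Jacobian matrix of
the system is the identity modulo `x`, hence invertible, so every derivation of the field
`K(x)(y)` that vanishes on `K(x)` is zero, and the field is algebraic over `K(x)`
(`isAlgebraic_adjoin_of_fixed_point`).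
-/

section

open MvPolynomial

/-! ### A Jacobian criterion for algebraicity -/

/-- The chain rule for a derivation applied to a polynomial expression in several elements. -/
theorem Derivation.aeval_eq_sum_pderiv {R A M ι : Type*} [CommRing R] [CommRing A] [Algebra R A]
    [AddCommGroup M] [Module A M] [Module R M] [IsScalarTower R A M] [Fintype ι]
    (D : Derivation R A M) (y : ι → A) (f : MvPolynomial ι R) :
    D (aeval y f) = ∑ j, aeval y (pderiv j f) • D (y j) := by
  classical
  induction f using MvPolynomial.induction_on with
  | C a => simp
  | add p q hp hq => simp [hp, hq, add_smul, Finset.sum_add_distrib]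
  | mul_X p i hp =>
    simp [hp, pderiv_X, Pi.single_apply, add_smul, mul_smul, Finset.sum_add_distrib,
      Finset.smul_sum, apply_ite]

/-- A Jacobian criterion for algebraicity: if `yᵢ = cᵢ + t Pᵢ(y)` with `cᵢ, t` in the field `k`, and
the Jacobian matrix of the system at `y` is invertible, then `k(y)` is algebraic over `k`. Applying
the universal derivation `d` of `k(y)` over `k` to the system gives a homogeneous linear system for
the `d yᵢ` with that matrix, so that `d = 0`; hence `k(y)` is formally unramified over `k`, and an
unramified finitely generated field extension is (separable) algebraic. -/
theorem isAlgebraic_adjoin_of_fixed_point {R k M ι : Type*} [CommRing R] [Field k] [Field M]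
    [Algebra R k] [Algebra k M] [Algebra R M] [IsScalarTower R k M] [Fintype ι] [DecidableEq ι]
    (y : ι → M) (c : ι → k) (t : k) (P : ι → MvPolynomial ι R)
    (hy : ∀ i, y i = algebraMap k M (c i) + algebraMap k M t * aeval y (P i))
    (hdet : (1 - Matrix.of fun i j => algebraMap k M t * aeval y (pderiv j (P i))).det ≠ 0) :
    Algebra.IsAlgebraic k (IntermediateField.adjoin k (Set.range y)) := by
  set L := IntermediateField.adjoin k (Set.range y)
  have hmem : ∀ i, y i ∈ L := fun i => IntermediateField.subset_adjoin k _ ⟨i, rfl⟩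
  let y' : ι → L := fun i => ⟨y i, hmem i⟩
  have hval : ∀ f : MvPolynomial ι R, ((aeval y' f : L) : M) = aeval y f := fun f => by
    have : IsScalarTower R L M := .of_algebraMap_eq fun _ => rfl
    exact (aeval_algebraMap_apply M y' f).symm
  have hy' : ∀ i, y' i = algebraMap k L (c i) + t • aeval y' (P i) := fun i => by
    apply Subtype.ext
    rw [IntermediateField.coe_add, IntermediateField.coe_smul, hval, Algebra.smul_def]
    exact hy i
  let J : Matrix ι ι L := 1 - Matrix.of fun i j => t • aeval y' (pderiv j (P i))
  have hJ : J.det ≠ 0 := by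
    intro h
    apply hdet
    have := congrArg (algebraMap L M) h
    rw [RingHom.map_det, map_zero] at this
    rw [← this]
    congr 1
    ext i j
    simp only [J, RingHom.mapMatrix_apply, Matrix.map_apply, Matrix.sub_apply, map_sub,
      Matrix.of_apply, Matrix.one_apply]
    congr 1
    · split_ifs <;> simp
    · rw [Algebra.smul_def, map_mul, ← IsScalarTower.algebraMap_apply]
      congr 1
      exact (hval _).symm
  -- The vector of the `d yᵢ` is in the kernel of the invertible matrix `J`.
  have hD : ∀ i, KaehlerDifferential.D k L (y' i) = 0 := by
    have hrow : ∀ i, ∑ j, J i j • KaehlerDifferential.D k L (y' j) = 0 := fun i => by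
      have h1 := congrArg (KaehlerDifferential.D k L) (hy' i)
      have h2 := ((KaehlerDifferential.D k L).restrictScalars R).aeval_eq_sum_pderiv y' (P i)
      simp only [Derivation.restrictScalars_apply] at h2
      rw [map_add, Derivation.map_algebraMap, zero_add, Derivation.map_smul, h2] at h1
      simp only [J, Matrix.sub_apply, sub_smul, Finset.sum_sub_distrib, Matrix.one_apply, ite_smul,
        one_smul, zero_smul, Finset.sum_ite_eq, Finset.mem_univ, if_true, Matrix.of_apply,
        smul_assoc, ← Finset.smul_sum]
      rw [h1, sub_self]
    intro i
    have h3 : ∑ l, (J⁻¹ * J) i l • KaehlerDifferential.D k L (y' l) = 0 := by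
      simp only [Matrix.mul_apply, Finset.sum_smul]
      rw [Finset.sum_comm]
      refine Finset.sum_eq_zero fun j _ => ?_
      simp only [mul_smul, ← Finset.smul_sum, hrow, smul_zero]
    rw [Matrix.nonsing_inv_mul J (isUnit_iff_ne_zero.mpr hJ)] at h3
    simpa [Matrix.one_apply] using h3
  have hD' : ∀ x (hx : x ∈ L), KaehlerDifferential.D k L ⟨x, hx⟩ = 0 := by
    intro x hx
    induction hx using IntermediateField.adjoin_induction with
    | mem x hx => obtain ⟨i, rfl⟩ := hx; exact hD i
    | algebraMap a => exact (KaehlerDifferential.D k L).map_algebraMap a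
    | add x z hx hz h1 h2 =>
      exact ((KaehlerDifferential.D k L).map_add ⟨x, hx⟩ ⟨z, hz⟩).trans (by rw [h1, h2, add_zero])
    | mul x z hx hz h1 h2 =>
      exact ((KaehlerDifferential.D k L).leibniz ⟨x, hx⟩ ⟨z, hz⟩).trans
        (by rw [h1, h2, smul_zero, smul_zero, add_zero])
    | inv x hx h1 =>
      exact ((KaehlerDifferential.D k L).leibniz_inv ⟨x, hx⟩).trans (by rw [h1, smul_zero])
  have : Algebra.FormallyUnramified k L := by
    refine ⟨?_⟩
    rw [← Submodule.subsingleton_iff L, ← subsingleton_iff_bot_eq_top, eq_comm,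
      ← KaehlerDifferential.span_range_derivation, Submodule.span_eq_bot]
    rintro _ ⟨x, rfl⟩
    exact hD' x x.2
  have : Algebra.EssFiniteType k L := by
    rw [IntermediateField.essFiniteType_iff]
    exact IntermediateField.fg_adjoin_of_finite (Set.finite_range y)
  have : Algebra.IsSeparable k L := (Algebra.FormallyUnramified.iff_isSeparable k L).mp inferInstance
  infer_instance

/-- The descent of `isAlgebraic_adjoin_of_fixed_point` from a field extension `M / k` to rings
`A ⊆ B` with `k = Frac A` and `B ⊆ M`. -/
theorem isAlgebraic_aeval_of_fixed_point_of_isFractionRing {R A B : Type*} (k M : Type*)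
    {ι : Type*} [CommRing R] [CommRing A] [CommRing B] [Field k] [Field M]
    [Algebra R A] [Algebra A B] [Algebra R B] [Algebra A k] [Algebra R k] [Algebra B M]
    [Algebra k M] [Algebra A M] [Algebra R M] [IsScalarTower A B M] [IsScalarTower A k M]
    [IsScalarTower R k M] [IsScalarTower R B M]
    [FaithfulSMul B M] [IsDomain A] [IsFractionRing A k] [Fintype ι] [DecidableEq ι]
    (y : ι → B) (c : ι → A) (t : A) (P : ι → MvPolynomial ι R)
    (hy : ∀ i, y i = algebraMap A B (c i) + algebraMap A B t * aeval y (P i))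
    (hdet : (1 - Matrix.of fun i j => algebraMap A B t * aeval y (pderiv j (P i))).det ≠ 0)
    (f : MvPolynomial ι R) : IsAlgebraic A (aeval y f) := by
  have hinj := FaithfulSMul.algebraMap_injective B M
  have hmap : ∀ f : MvPolynomial ι R,
      aeval (fun i => algebraMap B M (y i)) f = algebraMap B M (aeval y f) :=
    fun f => aeval_algebraMap_apply M y f
  have hA : ∀ a : A, algebraMap k M (algebraMap A k a) = algebraMap B M (algebraMap A B a) :=
    fun a => by rw [← IsScalarTower.algebraMap_apply, ← IsScalarTower.algebraMap_apply]
  have halg := isAlgebraic_adjoin_of_fixed_point (fun i => algebraMap B M (y i))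
    (fun i => algebraMap A k (c i)) (algebraMap A k t) P
    (fun i => by rw [hA, hA, hmap, ← map_mul, ← map_add, ← hy]) ?_
  · rw [← isAlgebraic_algebraMap_iff hinj, IsFractionRing.isAlgebraic_iff A k M]
    have hmem : algebraMap B M (aeval y f) ∈
        IntermediateField.adjoin k (Set.range fun i => algebraMap B M (y i)) := by
      rw [← hmap]
      have hp : aeval (fun i => algebraMap B M (y i)) f ∈
          Algebra.adjoin R (Set.range fun i => algebraMap B M (y i)) := by
        rw [← aeval_range]
        exact ⟨f, rfl⟩
      refine Algebra.adjoin_le (S := (IntermediateField.adjoin k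
        (Set.range fun i => algebraMap B M (y i))).toSubalgebra.restrictScalars R) ?_ hp
      exact IntermediateField.subset_adjoin _ _
    exact IntermediateField.isAlgebraic_iff.mp (halg.isAlgebraic ⟨_, hmem⟩)
  · rw [← (map_ne_zero_iff _ hinj), RingHom.map_det] at hdet
    convert hdet using 2
    ext i j
    rw [RingHom.mapMatrix_apply, Matrix.map_apply, Matrix.sub_apply, Matrix.sub_apply, map_sub,
      Matrix.of_apply, Matrix.of_apply, map_mul, hA, hmap]
    simp [Matrix.one_apply, apply_ite]

/-- The Jacobian criterion over domains: if `yᵢ = cᵢ + t Pᵢ(y)` and the Jacobian determinant of the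
system does not vanish at `y`, then every polynomial expression in `y` is algebraic. -/
theorem isAlgebraic_aeval_of_fixed_point {R A B ι : Type*} [CommRing R] [CommRing A] [IsDomain A]
    [CommRing B] [IsDomain B] [Algebra R A] [Algebra A B] [Algebra R B] [IsScalarTower R A B]
    [FaithfulSMul A B] [Fintype ι] [DecidableEq ι]
    (y : ι → B) (c : ι → A) (t : A) (P : ι → MvPolynomial ι R)
    (hy : ∀ i, y i = algebraMap A B (c i) + algebraMap A B t * aeval y (P i))
    (hdet : (1 - Matrix.of fun i j => algebraMap A B t * aeval y (pderiv j (P i))).det ≠ 0)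
    (f : MvPolynomial ι R) : IsAlgebraic A (aeval y f) := by
  let k := FractionRing A
  let M := FractionRing B
  have : FaithfulSMul A M := FaithfulSMul.trans A B M
  let : Algebra k M := FractionRing.liftAlgebra A M
  have : IsScalarTower A k M := FractionRing.isScalarTower_liftAlgebra A M
  have : IsScalarTower R A M := .to₁₂₄ R A B M
  have : IsScalarTower R k M := .to₁₃₄ R A k M
  exact isAlgebraic_aeval_of_fixed_point_of_isFractionRing k M y c t P hy hdet f

end

namespace PolyStream

open MvPolynomial

variable {K : Type*} [Field K] {n : ℕ}

/-! ### The product rule for the transition function -/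

/-- The algebra endomorphism `θ` of `K[x, x₁, …, xₙ]` with `θ(xᵢ) = xᵢ - x D(xᵢ)`. It corresponds to
replacing a stream `σ` by the constant stream with value `σ(0)`, as `σ - x × σ' = σ(0)`. -/
noncomputable def IVP.shift (E : IVP K n) : Poly K n →ₐ[K] Poly K n :=
  aeval fun i => X i - X 0 * E.driftExt i

theorem IVP.trans_monomial (E : IVP K n) (F : MvPolynomial (Fin 5) K) (G : Polynomial K)
    (m : Fin (n + 1) →₀ ℕ) : E.trans F G (monomial m 1) = E.transMonomial F G m :=
  (basisMonomials (Fin (n + 1)) K).constr_basis K _ m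

theorem aeval_convF {A : Type*} [CommRing A] [Algebra K A] (v : Fin 5 → A) :
    aeval v (convF K) = v 2 * v 3 + v 1 * v 4 - v 0 * v 2 * v 4 := by
  simp [convF]

/-- The identity `x δ(m) = m - θ(m)` on monomials, by induction along the recursion for `δ`: the
recursion step for `xᵢ m` is `θ(xᵢ m) = θ(xᵢ) θ(m)`, multiplied out. -/
theorem IVP.X_mul_transMonomial (E : IVP K n) (m : Fin (n + 1) →₀ ℕ) :
    X 0 * E.transMonomial (convF K) 0 m = monomial m 1 - E.shift (monomial m 1) := by
  induction h : m.degree using Nat.strong_induction_on generalizing m with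
  | _ d ih =>
    subst h
    rw [IVP.transMonomial]
    split_ifs with hm h1
    · subst hm
      have : (monomial (0 : Fin (n + 1) →₀ ℕ) (1 : K)) = 1 := rfl
      simp [this]
    all_goals
      set i := minVar m hm with hi
      have h2 : m = Finsupp.single i 1 + (m - Finsupp.single i 1) := by
        refine (add_tsub_cancel_of_le ?_).symm
        rw [Finsupp.single_le_iff]
        exact Nat.one_le_iff_ne_zero.mpr
          (Finsupp.mem_support_iff.mp (Finset.min'_mem _ _))
      have h3 : (monomial m (1 : K)) = X i * monomial (m - Finsupp.single i 1) 1 := by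
        rw [X, monomial_mul, ← h2, one_mul]
    · rw [h3, h1]
      have : (monomial (0 : Fin (n + 1) →₀ ℕ) (1 : K)) = 1 := rfl
      simp [this, IVP.shift]
    · have h4 := ih _ (degree_sub_minVar_lt m hm) _ rfl
      rw [← hi] at h4
      have h5 : E.shift (X i) = X i - X 0 * E.driftExt i := by simp [IVP.shift]
      rw [h3, map_mul, h5, aeval_convF]
      simp only [Matrix.cons_val]
      linear_combination (X i - X 0 * E.driftExt i) * h4

/-- The transition function is the difference quotient `δ(p) = (p - θ(p)) / x` of an algebra
endomorphism; in particular, it does not depend on the order of the variables that its recursive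
definition uses. -/
theorem IVP.X_mul_trans (E : IVP K n) (p : Poly K n) :
    X 0 * E.trans (convF K) 0 p = p - E.shift p := by
  suffices h : LinearMap.mulLeft K (X 0) ∘ₗ E.trans (convF K) 0
      = LinearMap.id - E.shift.toLinearMap from LinearMap.congr_fun h p
  refine (basisMonomials (Fin (n + 1)) K).ext fun m => ?_
  simpa [E.trans_monomial] using E.X_mul_transMonomial m

/-- The product rule of the convolution product, defining for the smallest variable of a monomial,
holds for any two polynomials. -/
theorem IVP.trans_mul (E : IVP K n) (p q : Poly K n) :
    E.trans (convF K) 0 (p * q) = E.trans (convF K) 0 p * q + p * E.trans (convF K) 0 q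
      - X 0 * E.trans (convF K) 0 p * E.trans (convF K) 0 q := by
  apply mul_left_cancel₀ (X_ne_zero (R := K) (0 : Fin (n + 1)))
  have hp := E.X_mul_trans p
  have hq := E.X_mul_trans q
  rw [E.X_mul_trans, map_mul]
  linear_combination (X 0 * E.trans (convF K) 0 q - q) * hp - E.shift p * hq

theorem IVP.trans_X_mul (E : IVP K n) (p : Poly K n) :
    E.trans (convF K) 0 (X 0 * p) = p := by
  apply mul_left_cancel₀ (X_ne_zero (R := K) (0 : Fin (n + 1)))
  rw [E.X_mul_trans, map_mul]
  simp [IVP.shift, IVP.driftExt]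

theorem IVP.trans_X (E : IVP K n) (i : Fin (n + 1)) :
    E.trans (convF K) 0 (X i) = E.driftExt i := by
  apply mul_left_cancel₀ (X_ne_zero (R := K) (0 : Fin (n + 1)))
  rw [E.X_mul_trans]
  simp [IVP.shift]

theorem IVP.trans_one (E : IVP K n) : E.trans (convF K) 0 1 = 0 := by
  apply mul_left_cancel₀ (X_ne_zero (R := K) (0 : Fin (n + 1)))
  rw [E.X_mul_trans]
  simp

/-! ### Generating functions are multiplicative -/

/-- The generating function of the stream `μ(p)`. -/
noncomputable def IVP.gen (E : IVP K n) (p : Poly K n) : PowerSeries K :=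
  ogf (E.muConv p)

/-- The coalgebra morphism property of `μ`, in terms of generating functions. -/
theorem IVP.gen_eq (E : IVP K n) (p : Poly K n) :
    E.gen p = PowerSeries.C (E.output p) + PowerSeries.X * E.gen (E.trans (convF K) 0 p) := by
  obtain ⟨h1, h2⟩ := (E.isCoalgebraMorphism_iff (convF K) 0 E.muConv).mpr rfl p
  ext (_ | k)
  · simpa [IVP.gen, ogf] using h1
  · rw [map_add, PowerSeries.coeff_succ_X_mul, PowerSeries.coeff_C, if_neg k.succ_ne_zero, zero_add,
      IVP.gen, IVP.gen, ← h2]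
    simp only [ogf, PowerSeries.coeff_mk]
    rfl

theorem IVP.coeff_zero_gen (E : IVP K n) (p : Poly K n) :
    PowerSeries.coeff 0 (E.gen p) = E.output p := by
  rw [gen_eq]; simp

theorem IVP.coeff_succ_gen (E : IVP K n) (p : Poly K n) (k : ℕ) :
    PowerSeries.coeff (k + 1) (E.gen p) = PowerSeries.coeff k (E.gen (E.trans (convF K) 0 p)) := by
  rw [gen_eq]; simp

theorem IVP.gen_add (E : IVP K n) (p q : Poly K n) : E.gen (p + q) = E.gen p + E.gen q := by
  ext k
  induction k generalizing p q with
  | zero => simp only [map_add, E.coeff_zero_gen]; simp [IVP.output]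
  | succ k ih => simp only [map_add, E.coeff_succ_gen] at ih ⊢; exact ih _ _

theorem IVP.gen_C (E : IVP K n) (a : K) : E.gen (C a) = PowerSeries.C a := by
  have h : ∀ k, PowerSeries.coeff k (E.gen 0) = 0 := fun k => by
    induction k with
    | zero => simp [E.coeff_zero_gen, IVP.output]
    | succ k ih => rw [E.coeff_succ_gen, map_zero, ih]
  ext (_ | k)
  · simp [E.coeff_zero_gen, IVP.output]
  · have h1 : E.trans (convF K) 0 (C a) = 0 := by
      rw [← mul_one (C a), ← smul_eq_C_mul, map_smul, E.trans_one, smul_zero]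
    rw [E.coeff_succ_gen, h1, h, PowerSeries.coeff_C, if_neg k.succ_ne_zero]

theorem IVP.gen_X_mul (E : IVP K n) (p : Poly K n) :
    E.gen (X 0 * p) = PowerSeries.X * E.gen p := by
  rw [gen_eq, E.trans_X_mul]
  simp [IVP.output, IVP.initExt]

/-- `μ` turns products of polynomials into convolution products. Both sides satisfy the same
recursion, so that they agree modulo `x ^ k` for all `k`. -/
theorem IVP.gen_mul (E : IVP K n) (p q : Poly K n) : E.gen (p * q) = E.gen p * E.gen q := by
  suffices h : ∀ k p q, PowerSeries.X ^ k ∣ E.gen (p * q) - E.gen p * E.gen q by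
    ext k
    have := PowerSeries.X_pow_dvd_iff.mp (h (k + 1) p q) k k.lt_succ_self
    rwa [map_sub, sub_eq_zero] at this
  intro k
  induction k with
  | zero => simp
  | succ k ih =>
    intro p q
    set δ := E.trans (convF K) 0
    have h1 : E.gen (δ (p * q)) + PowerSeries.X * E.gen (δ p * δ q)
        = E.gen (δ p * q) + E.gen (p * δ q) := by
      rw [← E.gen_X_mul, ← E.gen_add, ← E.gen_add]
      congr 1
      rw [E.trans_mul]
      ring
    -- The defect of multiplicativity at `(p, q)` is `x` times a combination of defects.
    have h2 : E.gen (p * q) - E.gen p * E.gen q = PowerSeries.X *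
        ((E.gen (δ p * q) - E.gen (δ p) * E.gen q) + (E.gen (p * δ q) - E.gen p * E.gen (δ q))
          - PowerSeries.X * (E.gen (δ p * δ q) - E.gen (δ p) * E.gen (δ q))) := by
      have ho : PowerSeries.C (E.output (p * q))
          = PowerSeries.C (E.output p) * PowerSeries.C (E.output q) := by
        simp [IVP.output]
      have hpq := E.gen_eq (p * q)
      have hp := E.gen_eq p
      have hq := E.gen_eq q
      linear_combination hpq + ho + PowerSeries.X * h1 - (E.gen q - PowerSeries.X * E.gen (δ q)) * hp
        - (PowerSeries.C (E.output p)) * hq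
    rw [h2, pow_succ']
    exact mul_dvd_mul_left _ (dvd_sub (dvd_add (ih _ _) (ih _ _)) ((ih _ _).mul_left _))

/-- The generating function of `μ(p)`, as an algebra homomorphism in `p`. -/
noncomputable def IVP.genHom (E : IVP K n) : Poly K n →ₐ[K] PowerSeries K where
  toFun := E.gen
  map_one' := by rw [← C_1, gen_C, map_one]
  map_zero' := by rw [← C_0, gen_C, map_zero]
  map_add' := E.gen_add
  map_mul' := E.gen_mul
  commutes' := E.gen_C

/-! ### Algebraicity -/

/-- Algebraicity over the ring `K[x]` in the sense of Mathlib gives a bivariate annihilating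
polynomial. -/
theorem isAlgebraicSeries_of_isAlgebraic {g : PowerSeries K}
    (h : IsAlgebraic (Polynomial K) g) : IsAlgebraicSeries g := by
  obtain ⟨q, hq, hq0⟩ := h
  let e := Polynomial.Bivariate.equivMvPolynomial K
  refine ⟨e q, e.map_ne_zero_iff.mpr hq, ?_⟩
  have hcomp : (aeval ![PowerSeries.X, g]).comp e.toAlgHom
      = (Polynomial.aeval (R := Polynomial K) g).restrictScalars K := by
    ext
    · simp [e, PowerSeries.algebraMap_apply']
    · simp [e]
  have := DFunLike.congr_fun hcomp q
  simpa [hq0] using this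

/-- A power series solution of a polynomial system `yᵢ = cᵢ + x Pᵢ(y)` is algebraic. The Jacobian
criterion applies since the Jacobian matrix of the system is the identity modulo `x`. -/
theorem isAlgebraic_aeval_of_powerSeries_fixed_point {ι : Type*} [Fintype ι] (y : ι → PowerSeries K)
    (c : ι → K) (P : ι → MvPolynomial ι K)
    (hy : ∀ i, y i = PowerSeries.C (c i) + PowerSeries.X * aeval y (P i))
    (f : MvPolynomial ι K) : IsAlgebraic (Polynomial K) (aeval y f) := by
  classical
  have : FaithfulSMul (Polynomial K) (PowerSeries K) := by
    rw [faithfulSMul_iff_algebraMap_injective]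
    intro p q h
    simpa [PowerSeries.algebraMap_apply'] using h
  have hX : algebraMap (Polynomial K) (PowerSeries K) Polynomial.X = PowerSeries.X := by
    simp [PowerSeries.algebraMap_apply']
  refine isAlgebraic_aeval_of_fixed_point y (fun i => Polynomial.C (c i)) Polynomial.X P
    (fun i => ?_) ?_ f
  · rw [hX, hy i]
    simp [PowerSeries.algebraMap_apply']
  · rw [hX]
    intro h
    have h1 := congrArg (PowerSeries.constantCoeff (R := K)) h
    rw [RingHom.map_det, map_zero] at h1
    have h2 : (PowerSeries.constantCoeff (R := K)).mapMatrix
        (1 - Matrix.of fun i j => PowerSeries.X * aeval y (pderiv j (P i))) = 1 := by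
      ext i j
      simp [Matrix.one_apply, apply_ite]
    rw [h2, Matrix.det_one] at h1
    exact one_ne_zero h1

/-- The streams `μ(p)` of the convolution product are algebraic over any field `K`: the generating
functions `yᵢ` of `μ(xᵢ)` solve the system `yᵢ = xᵢ(0) + x D(xᵢ)(y)`. -/
theorem IVP.isAlgebraicStream_muConv (E : IVP K n) (p : Poly K n) :
    IsAlgebraicStream (E.muConv p) := by
  have haeval : ∀ f, aeval (fun i => E.genHom (X i)) f = E.gen f := fun f =>
    (DFunLike.congr_fun (aeval_unique E.genHom) f).symm
  have h := isAlgebraic_aeval_of_powerSeries_fixed_point (fun i => E.genHom (X i)) E.initExt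
    E.driftExt (fun i => ?_) p
  · rw [haeval] at h
    exact isAlgebraicSeries_of_isAlgebraic h
  · have := E.gen_eq (X i)
    rw [E.trans_X, IVP.output, eval_X] at this
    rw [haeval]
    exact this

end PolyStream

theorem corollary5 (n : ℕ) (E : PolyStream.IVP ℚ n) (p : PolyStream.Poly ℚ n) :
    PolyStream.IsAlgebraicStream (E.muConv p) :=
  E.isAlgebraicStream_muConv p
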